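/- Let $G$ be a locally compact, $\sigma$-compact, Hausdorff abelian group. Let $C_c(G)$ be the space of continuous functions $G\to\mathbb C$ with compact support, with the locally convex inductive limit topology of the spaces $C_K(G)$, $K\subset G$ compact, of functions supported in $K$ with the supremum norm. Put $\tau_t\varphi=\varphi(\cdot-t)$. Let $M(G)$ be the dual of $C_c(G)$ (the complex Radon measures on $G$) with the vague (weak-$*$) topology, and let $G$ act on it by $(\alpha_t\nu)(\varphi)=\nu(\tau_{-t}\varphi)$. A measure $\nu\in M(G)$ is translation bounded if $t\mapsto\nu(\tau_t\varphi)$ is bounded for every $\varphi\in C_c(G)$. A spatial process $\mathcal N=(N,X,m,T)$ over $G$ consists of a measurable space $X$ with an action $\alpha$ of $G$ that is measurable in each variable (for instance a continuous action on a compact Hausdorff space), a $G$-invariant probability measure $m$ on $X$, and a linear and continuous map $N:C_c(G)\to L^2(X,m)$ with $N(\overline\varphi)=\overline{N(\varphi)}$ and $T_t\circ N=N\circ\tau_t$ for all $t\in G$, where $T_tf=f\circ\alpha_{-t}$. It is full if the linear span of the products $\vartheta_1(N(\varphi_1))\cdots\vartheta_n(N(\varphi_n))$, with $n\in\mathbb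 N$, $\vartheta_j\in C_c(\mathbb C)$ and $\varphi_j\in C_c(G)$, is dense in $L^2(X,m)$. Two spatial processes $(N,X,m,T)$ and $(N',X',m',T')$ are spatially isomorphic if there is a unitary map $U:L^2(X,m)\to L^2(X',m')$ with $U\circ N=N'$, with $U\circ T_t=T'_t\circ U$ for all $t\in G$, with $U(fg)=U(f)U(g)$ for all $f,g\in L^\infty(X,m)$, and with $U^{-1}(f'g')=U^{-1}(f')U^{-1}(g')$ for all $f',g'\in L^\infty(X',m')$. A translation bounded measure dynamical system is a compact, translation invariant set $Y\subset M(G)$ of translation bounded measures with the restricted action, which is continuous on $G\times Y$. Together with a $G$-invariant regular Borel probability measure $m'$ on $Y$, it gives the spatial process $(N',Y,m',T')$ with $N'(\varphi)(\nu)=\nu(\varphi)$. Theorem. Let $\mathcal N=(N,X,m,T)$ be a full spatial process over $G$ with $N(\varphi)\in L^\infty(X,m)$ for all $\varphi\in C_c(G)$. Then $\mathcal N$ is spatially isomorphic to the spatial process $(N',Y,m',T')$ of a translation bounded measure dynamical system. Moreover, $Y$ can be chosen as follows. Let $\mathcal A\subset L^\infty(X,m)$ be the unital C*-subalgebra generated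 by $N(C_c(G))$ and let $\hat{\mathcal A}$ be its Gelfand spectrum. Then there is a homeomorphism $\Theta:\hat{\mathcal A}\to Y$ with $\Theta(x)(\varphi)=x(N(\varphi))$ for all $x\in\hat{\mathcal A}$ and $\varphi\in C_c(G)$. -/

import Mathlib

open MeasureTheory
open scoped CompactlySupported ENNReal Topology

noncomputable section

/-! ### The commutative C*-algebra `L^∞(X, μ)` -/

namespace LInfty

variable {X : Type*} [MeasurableSpace X] {μ : Measure X}

/-- Pointwise (a.e.) multiplication of essentially bounded functions. -/
instance instMul : Mul (Lp ℂ ∞ μ) where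
  mul f g := ⟨(f : X →ₘ[μ] ℂ) * (g : X →ₘ[μ] ℂ), by
    rw [Lp.mem_Lp_iff_memLp]
    exact ((Lp.memLp g).mul (r := ∞) (Lp.memLp f)).ae_eq (AEEqFun.coeFn_mul _ _).symm⟩

/-- The constant function one. -/
instance instOne : One (Lp ℂ ∞ μ) where
  one := ⟨(1 : X →ₘ[μ] ℂ), by
    rw [Lp.mem_Lp_iff_memLp]
    exact (memLp_top_const (1 : ℂ)).ae_eq (AEEqFun.coeFn_one).symm⟩

theorem coeFn_mul (f g : Lp ℂ ∞ μ) : ⇑(f * g) =ᵐ[μ] ⇑f * ⇑g := AEEqFun.coeFn_mul _ _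

theorem coeFn_one : ⇑(1 : Lp ℂ ∞ μ) =ᵐ[μ] 1 := AEEqFun.coeFn_one

theorem mul_comm' (f g : Lp ℂ ∞ μ) : f * g = g * f :=
  Subtype.ext (mul_comm (f : X →ₘ[μ] ℂ) g)

theorem one_mul' (f : Lp ℂ ∞ μ) : 1 * f = f := Subtype.ext (one_mul (f : X →ₘ[μ] ℂ))

theorem mul_assoc' (f g h : Lp ℂ ∞ μ) : f * g * h = f * (g * h) :=
  Subtype.ext (mul_assoc (f : X →ₘ[μ] ℂ) g h)

theorem mul_add' (f g h : Lp ℂ ∞ μ) : f * (g + h) = f * g + f * h := by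
  apply Lp.ext
  filter_upwards [coeFn_mul f (g + h), coeFn_mul f g, coeFn_mul f h, Lp.coeFn_add g h,
    Lp.coeFn_add (f * g) (f * h)] with x h1 h2 h3 h4 h5
  simp only [h1, h2, h3, h4, h5, Pi.mul_apply, Pi.add_apply, mul_add]

theorem smul_mul' (c : ℂ) (f g : Lp ℂ ∞ μ) : c • f * g = c • (f * g) := by
  apply Lp.ext
  filter_upwards [coeFn_mul (c • f) g, coeFn_mul f g, Lp.coeFn_smul c f,
    Lp.coeFn_smul c (f * g)] with x h1 h2 h3 h4
  simp only [h1, h2, h3, h4, Pi.mul_apply, Pi.smul_apply, smul_eq_mul, mul_assoc]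

theorem norm_le_of_ae_bound (f : Lp ℂ ∞ μ) {C : ℝ} (hC : 0 ≤ C)
    (h : ∀ᵐ x ∂μ, ‖f x‖ ≤ C) : ‖f‖ ≤ C := by
  rw [Lp.norm_def, eLpNorm_exponent_top]
  exact ENNReal.toReal_le_of_le_ofReal hC (eLpNormEssSup_le_of_ae_bound h)

theorem ae_norm_le (f : Lp ℂ ∞ μ) : ∀ᵐ x ∂μ, ‖f x‖ ≤ ‖f‖ := by
  filter_upwards [ae_le_eLpNormEssSup (f := f) (μ := μ)] with x hx
  rw [Lp.norm_def, eLpNorm_exponent_top, ← toReal_enorm]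
  refine ENNReal.toReal_mono ?_ hx
  rw [← eLpNorm_exponent_top]
  exact Lp.eLpNorm_ne_top f

theorem norm_mul_le' (f g : Lp ℂ ∞ μ) : ‖f * g‖ ≤ ‖f‖ * ‖g‖ := by
  refine norm_le_of_ae_bound _ (mul_nonneg (norm_nonneg _) (norm_nonneg _)) ?_
  filter_upwards [coeFn_mul f g, ae_norm_le f, ae_norm_le g] with x h1 h2 h3
  rw [h1, Pi.mul_apply, norm_mul]
  gcongr

instance instCommRing : CommRing (Lp ℂ ∞ μ) where
  __ := (inferInstance : AddCommGroup (Lp ℂ ∞ μ))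
  __ := instMul
  __ := instOne
  mul_assoc := mul_assoc'
  one_mul := one_mul'
  mul_one f := by rw [mul_comm', one_mul']
  left_distrib := mul_add'
  right_distrib f g h := by rw [mul_comm', mul_add', mul_comm' h f, mul_comm' h g]
  mul_comm := mul_comm'
  zero_mul f := by
    have := mul_add' f 0 0
    rw [add_zero, left_eq_add] at this
    rw [mul_comm', this]
  mul_zero f := by
    have := mul_add' f 0 0
    rwa [add_zero, left_eq_add] at this

instance instNormedCommRing : NormedCommRing (Lp ℂ ∞ μ) where
  __ := (inferInstance : NormedAddCommGroup (Lp ℂ ∞ μ))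
  __ := instCommRing
  norm_mul_le := norm_mul_le'

instance instNormedAlgebra : NormedAlgebra ℂ (Lp ℂ ∞ μ) where
  __ := Algebra.ofModule smul_mul' fun c f g =>
    (mul_comm' f (c • g)).trans ((smul_mul' c g f).trans (congrArg (c • ·) (mul_comm' g f)))
  norm_smul_le := norm_smul_le

instance instStarRing : StarRing (Lp ℂ ∞ μ) where
  star_mul f g := by
    apply Lp.ext
    filter_upwards [Lp.coeFn_star (f * g), coeFn_mul f g, coeFn_mul (star g) (star f),
      Lp.coeFn_star f, Lp.coeFn_star g] with x h1 h2 h3 h4 h5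
    rw [h1, Pi.star_apply, h2, Pi.mul_apply, h3, Pi.mul_apply, h4, h5, Pi.star_apply,
      Pi.star_apply, star_mul]
  star_add f g := by
    apply Lp.ext
    filter_upwards [Lp.coeFn_star (f + g), Lp.coeFn_add f g, Lp.coeFn_add (star f) (star g),
      Lp.coeFn_star f, Lp.coeFn_star g] with x h1 h2 h3 h4 h5
    simp only [h1, h2, h3, h4, h5, Pi.star_apply, Pi.add_apply, star_add]

instance instStarModule : StarModule ℂ (Lp ℂ ∞ μ) where
  star_smul c f := by
    apply Lp.ext
    filter_upwards [Lp.coeFn_star (c • f), Lp.coeFn_smul c f, Lp.coeFn_smul (star c) (star f),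
      Lp.coeFn_star f] with x h1 h2 h3 h4
    simp only [h1, h2, h3, h4, Pi.star_apply, Pi.smul_apply, star_smul]

instance instCStarRing : CStarRing (Lp ℂ ∞ μ) where
  norm_mul_self_le f := by
    have key : ‖f‖ ≤ √‖star f * f‖ := by
      refine norm_le_of_ae_bound _ (Real.sqrt_nonneg _) ?_
      filter_upwards [coeFn_mul (star f) f, Lp.coeFn_star f,
        ae_norm_le (star f * f)] with x h1 h2 h3
      rw [h1, Pi.mul_apply, h2, Pi.star_apply, CStarRing.norm_star_mul_self] at h3
      exact Real.le_sqrt_of_sq_le (by rw [sq]; exact h3)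
    calc ‖f‖ * ‖f‖ ≤ √‖star f * f‖ * √‖star f * f‖ := by gcongr
      _ = ‖star f * f‖ := Real.mul_self_sqrt (norm_nonneg _)

instance instCommCStarAlgebra : CommCStarAlgebra (Lp ℂ ∞ μ) where

end LInfty


/-! ### The space `C_c(G)` and its dual -/

section CompactSupport

open CompactlySupportedContinuousMap

variable {G : Type*} [TopologicalSpace G]

/-- The supremum-norm topology on `C_K(G)`, the space of continuous functions supported in `K`. -/
@[reducible] def supNormTopologyOn (K : Set G) :
    TopologicalSpace {φ : C_c(G, ℂ) // tsupport φ ⊆ K} :=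
  TopologicalSpace.induced (fun φ => toBoundedContinuousFunction φ.1) inferInstance

/-- The locally convex inductive limit topology on `C_c(G)`: the finest locally convex vector space
topology for which all the inclusions `C_K(G) → C_c(G)`, `K` compact, are continuous. -/
instance ccTopology : TopologicalSpace C_c(G, ℂ) :=
  sInf {t : TopologicalSpace C_c(G, ℂ) |
    (∀ K : Set G, IsCompact K → Continuous[supNormTopologyOn K, t] Subtype.val) ∧
    @IsTopologicalAddGroup C_c(G, ℂ) t _ ∧
    @ContinuousSMul ℂ C_c(G, ℂ) _ _ t ∧
    @LocallyConvexSpace ℝ C_c(G, ℂ) _ _ _ _ t}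

instance ccIsTopologicalAddGroup : IsTopologicalAddGroup C_c(G, ℂ) :=
  topologicalAddGroup_sInf fun _ ⟨_, ht, _, _⟩ => ht

instance ccContinuousSMul : ContinuousSMul ℂ C_c(G, ℂ) :=
  continuousSMul_sInf fun _ ⟨_, _, ht, _⟩ => ht

instance ccLocallyConvexSpace : LocallyConvexSpace ℝ C_c(G, ℂ) :=
  .sInf fun _ ⟨_, _, _, ht⟩ => ht

theorem continuous_ccInclusion {K : Set G} (hK : IsCompact K) :
    Continuous[supNormTopologyOn K, ccTopology] Subtype.val :=
  continuous_sInf_rng.2 fun _ ht => ht.1 K hK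

/-- The universal property of the inductive limit topology. -/
theorem continuous_cc_iff {E : Type*} [AddCommGroup E] [Module ℂ E] [Module ℝ E]
    [IsScalarTower ℝ ℂ E] [t : TopologicalSpace E] [IsTopologicalAddGroup E] [ContinuousSMul ℂ E]
    [LocallyConvexSpace ℝ E] (L : C_c(G, ℂ) →ₗ[ℂ] E) :
    Continuous L ↔ ∀ K : Set G, IsCompact K →
      Continuous[supNormTopologyOn K, t] fun φ => L φ.1 := by
  constructor
  · intro hL K hK
    exact @Continuous.comp _ _ _ (supNormTopologyOn K) _ _ _ _ hL (continuous_ccInclusion hK)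
  · intro h
    rw [continuous_iff_le_induced]
    refine sInf_le ⟨fun K hK => ?_, topologicalAddGroup_induced L, continuousSMul_induced L,
      LocallyConvexSpace.induced (L.restrictScalars ℝ)⟩
    rw [continuous_induced_rng]
    exact h K hK

variable [AddCommGroup G] [IsTopologicalAddGroup G]

/-- The translation `τ_t φ = φ(· - t)` on `C_c(G)`. -/
def ccTranslate (t : G) (φ : C_c(G, ℂ)) : C_c(G, ℂ) where
  toFun s := φ (s - t)
  continuous_toFun := by fun_prop
  hasCompactSupport' := φ.hasCompactSupport.comp_homeomorph (Homeomorph.subRight t)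

theorem ccTranslate_apply (t : G) (φ : C_c(G, ℂ)) (s : G) : ccTranslate t φ s = φ (s - t) := rfl

/-- `τ_t` as a continuous linear map on `C_c(G)`. -/
def ccTranslateL (t : G) : C_c(G, ℂ) →L[ℂ] C_c(G, ℂ) where
  toFun := ccTranslate t
  map_add' _ _ := rfl
  map_smul' _ _ := rfl
  cont := by
    let L : C_c(G, ℂ) →ₗ[ℂ] C_c(G, ℂ) :=
      { toFun := ccTranslate t, map_add' := fun _ _ => rfl, map_smul' := fun _ _ => rfl }
    refine (continuous_cc_iff L).2 fun K hK => ?_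
    have hK' : IsCompact (Homeomorph.subRight t ⁻¹' K) :=
      (Homeomorph.subRight t).isCompact_preimage.2 hK
    let j : {φ : C_c(G, ℂ) // tsupport φ ⊆ K} →
        {φ : C_c(G, ℂ) // tsupport φ ⊆ Homeomorph.subRight t ⁻¹' K} := fun φ =>
      ⟨ccTranslate t φ.1, by
        refine (tsupport_comp_subset_preimage φ.1 (Homeomorph.subRight t).continuous).trans ?_
        exact Set.preimage_mono φ.2⟩
    have hj : Continuous[supNormTopologyOn K, supNormTopologyOn _] j := by
      refine continuous_induced_rng.2 ?_
      exact @Continuous.comp _ _ _ (supNormTopologyOn K) _ _ _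
        (fun f : BoundedContinuousFunction G ℂ =>
          f.compContinuous (Homeomorph.subRight t : C(G, G)))
        (BoundedContinuousFunction.continuous_compContinuous _) continuous_induced_dom
    exact @Continuous.comp _ _ _ (supNormTopologyOn K) (supNormTopologyOn _) _ _ _
      (continuous_ccInclusion hK') hj

end CompactSupport

/-- `M(G)`: the dual of `C_c(G)`, that is, the (complex Radon) measures on `G`, with the vague
topology. The value `ν φ` is the integral of `φ` with respect to `ν`. -/
abbrev MeasuresOn (G : Type*) [TopologicalSpace G] : Type _ := WeakDual ℂ C_c(G, ℂ)

namespace MeasuresOn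

variable {G : Type*} [TopologicalSpace G]

/-- The Borel σ-algebra of the vague topology. -/
instance instMeasurableSpace : MeasurableSpace (MeasuresOn G) := borel _

instance instBorelSpace : BorelSpace (MeasuresOn G) := ⟨rfl⟩

variable [AddCommGroup G] [IsTopologicalAddGroup G]

/-- A measure `ν` is translation bounded if `t ↦ ν(τ_t φ)` is bounded for every `φ ∈ C_c(G)`. -/
def IsTranslationBounded (ν : MeasuresOn G) : Prop :=
  ∀ φ : C_c(G, ℂ), ∃ C : ℝ, ∀ t : G, ‖ν (ccTranslate t φ)‖ ≤ C

/-- The translation action `α_t ν = δ_t * ν`, i.e. `(α_t ν)(φ) = ν(τ_{-t} φ)`. -/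
def shift (t : G) (ν : MeasuresOn G) : MeasuresOn G :=
  StrongDual.toWeakDual ((WeakDual.toStrongDual ν).comp (ccTranslateL (-t)))

theorem shift_apply (t : G) (ν : MeasuresOn G) (φ : C_c(G, ℂ)) :
    shift t ν φ = ν (ccTranslate (-t) φ) := rfl

end MeasuresOn

/-! ### Spatial processes -/

/-- An action of `G` on a measurable space `X`, measurable in each variable, together with an
invariant probability measure. -/
structure ProbabilitySystem (G X : Type*) [AddCommGroup G] [MeasurableSpace G]
    [MeasurableSpace X] where
  act : G → X → X
  act_zero : ∀ x, act 0 x = x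
  act_add : ∀ s t x, act (s + t) x = act s (act t x)
  measurable_act : ∀ t, Measurable (act t)
  measurable_orbit : ∀ x, Measurable fun t => act t x
  m : Measure X
  isProbabilityMeasure : IsProbabilityMeasure m
  invariant : ∀ t, m.map (act t) = m

namespace ProbabilitySystem

variable {G X : Type*} [AddCommGroup G] [MeasurableSpace G] [MeasurableSpace X]

theorem measurePreserving (S : ProbabilitySystem G X) (t : G) :
    MeasurePreserving (S.act t) S.m S.m := ⟨S.measurable_act t, S.invariant t⟩

/-- The Koopman operator `T_t f = f ∘ α_{-t}` on `L²(X, m)`. -/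
def koopman (S : ProbabilitySystem G X) (t : G) : Lp ℂ 2 S.m →ₗᵢ[ℂ] Lp ℂ 2 S.m :=
  Lp.compMeasurePreservingₗᵢ ℂ (S.act (-t)) (S.measurePreserving (-t))

end ProbabilitySystem

/-- A spatial process over `G`: a dynamical system with an invariant probability measure `m` and
a continuous linear map `N : C_c(G) → L²(X, m)` which commutes with complex conjugation and with
translations. -/
structure SpatialProcess (G X : Type*) [AddCommGroup G] [TopologicalSpace G]
    [IsTopologicalAddGroup G] [MeasurableSpace G] [MeasurableSpace X] extends
    ProbabilitySystem G X where
  N : C_c(G, ℂ) →L[ℂ] Lp ℂ 2 m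
  N_star : ∀ φ, N (star φ) = star (N φ)
  koopman_N : ∀ t φ, toProbabilitySystem.koopman t (N φ) = N (ccTranslate t φ)

namespace SpatialProcess

variable {G X X' : Type*} [AddCommGroup G] [TopologicalSpace G] [IsTopologicalAddGroup G]
  [MeasurableSpace G] [MeasurableSpace X] [MeasurableSpace X']

/-- A spatial process is full if the span of the products `ϑ₁(N φ₁) ⋯ ϑₙ(N φₙ)`, with
`ϑⱼ ∈ C_c(ℂ)` and `φⱼ ∈ C_c(G)`, is dense in `L²(X, m)`. -/
def IsFull (P : SpatialProcess G X) : Prop :=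
  Dense (Submodule.span ℂ {h : Lp ℂ 2 P.m | ∃ (n : ℕ) (ϑ : Fin n → C_c(ℂ, ℂ))
    (φ : Fin n → C_c(G, ℂ)), h =ᵐ[P.m] fun x => ∏ j, ϑ j (P.N (φ j) x)} : Set (Lp ℂ 2 P.m))

/-- A unitary map is a spatial isomorphism if it intertwines the maps `N` and the Koopman
operators, and it and its inverse are multiplicative on bounded functions. -/
structure IsSpatialIsomorphism (P : SpatialProcess G X) (Q : SpatialProcess G X')
    (U : Lp ℂ 2 P.m ≃ₗᵢ[ℂ] Lp ℂ 2 Q.m) : Prop where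
  map_N : ∀ φ, U (P.N φ) = Q.N φ
  map_koopman : ∀ t f, U (P.koopman t f) = Q.koopman t (U f)
  map_mul : ∀ f g h : Lp ℂ 2 P.m, MemLp f ∞ P.m → MemLp g ∞ P.m → h =ᵐ[P.m] f * g →
    U h =ᵐ[Q.m] U f * U g
  symm_map_mul : ∀ f g h : Lp ℂ 2 Q.m, MemLp f ∞ Q.m → MemLp g ∞ Q.m → h =ᵐ[Q.m] f * g →
    U.symm h =ᵐ[P.m] U.symm f * U.symm g

/-- Equivalence (spatial isomorphy) of spatial processes. -/
def Equivalent (P : SpatialProcess G X) (Q : SpatialProcess G X') : Prop :=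
  ∃ U : Lp ℂ 2 P.m ≃ₗᵢ[ℂ] Lp ℂ 2 Q.m, IsSpatialIsomorphism P Q U

/-- `Q` is the spatial process of a translation bounded measure dynamical system: its space `Y` is
a compact, translation invariant set of translation bounded measures with the vague topology, `G`
acts on it by translations, its measure is a regular Borel measure, and `N(φ)(ν) = ν(φ)`. -/
structure IsTBMDS {Y : Set (MeasuresOn G)} (Q : SpatialProcess G Y) : Prop where
  isCompact : IsCompact Y
  translationBounded : ∀ ν ∈ Y, MeasuresOn.IsTranslationBounded ν
  shift_mem : ∀ t, ∀ ν ∈ Y, MeasuresOn.shift t ν ∈ Y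
  act_eq : ∀ t (ν : Y), (Q.act t ν : MeasuresOn G) = MeasuresOn.shift t ν
  continuous_act : Continuous fun p : G × Y => Q.act p.1 p.2
  regular : Q.m.Regular
  N_eq : ∀ φ, Q.N φ =ᵐ[Q.m] fun ν => (ν : MeasuresOn G) φ

/-- The unital C*-subalgebra of `L^∞(X, m)` generated by the functions `N(φ)`, `φ ∈ C_c(G)`. -/
def algebra (P : SpatialProcess G X) : StarSubalgebra ℂ (Lp ℂ ∞ P.m) :=
  (StarAlgebra.adjoin ℂ {f : Lp ℂ ∞ P.m | ∃ φ, f =ᵐ[P.m] P.N φ}).topologicalClosure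

/-- `N(φ)` as an element of the algebra, when it is essentially bounded. -/
def algebraN (P : SpatialProcess G X) (hP : ∀ φ, MemLp (P.N φ) ∞ P.m) (φ : C_c(G, ℂ)) :
    P.algebra :=
  ⟨(hP φ).toLp _, StarSubalgebra.le_topologicalClosure _
    (StarAlgebra.subset_adjoin ℂ _ ⟨φ, (hP φ).coeFn_toLp⟩)⟩

end SpatialProcess

end

/-!
The space `Y` is the Gelfand spectrum of `A = P.algebra`, seen as a set of measures: a character `x`
of `A` is sent to the functional `φ ↦ x (N φ)`.

This functional is continuous on `C_c(G)` because `N` is continuous as a map to `L^∞`, not only to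
`L²`. On each Banach space `C_K(G)` this is the closed graph theorem, and continuity on the
inductive limit follows (`continuous_cc_of_comp_injective`). As `N(C_c(G))` generates `A`, the map
from characters to measures is injective, hence a homeomorphism of the compact spectrum onto its
range `Y`. Composition of characters with the Koopman operators becomes translation on `Y`; this
action is jointly continuous, since `t ↦ N (τ_t φ)` is continuous for the norm of `L^∞`
(`SpatialProcess.continuous_translate`). Compactness and invariance of `Y` make its elements
translation bounded.

Gelfand duality now reads `C(Y) ≃ A ⊆ L^∞(m)`, and integration with respect to `m` is a positive
functional on `C(Y)`. The Riesz-Markov-Kakutani theorem represents it by a regular probability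
measure `m'`, and then `C(Y) → A` is isometric for the `L²` norms of `m'` and `m`. Continuous
functions are dense in `L²(m')`, and `A` is dense in `L²(m)`: by Stone-Weierstrass `A` contains all
`ϑ(N φ)` and their products, so that this is fullness (`SpatialProcess.dense_toL2_algebra`). Hence
the isometry extends to a unitary map `V : L²(m') → L²(m)`
(`exists_measure_linearIsometryEquiv`), and `V⁻¹` is the isomorphism sought. The intertwining
relations are checked on `C(Y)`. Multiplicativity passes from the dense subalgebras to all
bounded functions by convergence almost everywhere along subsequences (`map_mul_of_dense`).
-/

noncomputable section

open Filter

/-! ### The inclusion of `L^∞` into `L²` -/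

namespace LInfty

variable {X : Type*} [MeasurableSpace X] {μ : Measure X}

theorem coeFn_star_mul_self (f : Lp ℂ ∞ μ) :
    ⇑(star f * f) =ᵐ[μ] fun x => ((‖f x‖ ^ 2 : ℝ) : ℂ) := by
  filter_upwards [coeFn_mul (star f) f, Lp.coeFn_star f] with x h1 h2
  rw [h1, Pi.mul_apply, h2, Pi.star_apply, RCLike.star_def, Complex.conj_mul', Complex.ofReal_pow]

section FiniteMeasure

variable [IsFiniteMeasure μ]

theorem integrable (f : Lp ℂ ∞ μ) : Integrable f μ :=
  (Lp.memLp f).integrable le_top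

/-- The inclusion of `L^∞` into `L²` for a finite measure. -/
def toL2 : Lp ℂ ∞ μ →ₗ[ℂ] Lp ℂ 2 μ where
  toFun f := ((Lp.memLp f).mono_exponent le_top).toLp f
  map_add' f g := by
    rw [← MemLp.toLp_add]
    exact MemLp.toLp_congr _ _ (Lp.coeFn_add f g)
  map_smul' c f := by
    rw [RingHom.id_apply, ← MemLp.toLp_const_smul]
    exact MemLp.toLp_congr _ _ (Lp.coeFn_smul c f)

theorem coeFn_toL2 (f : Lp ℂ ∞ μ) : ⇑(toL2 f) =ᵐ[μ] f :=
  ((Lp.memLp f).mono_exponent le_top).coeFn_toLp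

theorem toL2_injective : Function.Injective (toL2 : Lp ℂ ∞ μ →ₗ[ℂ] Lp ℂ 2 μ) := fun f g h =>
  Lp.ext <| (coeFn_toL2 f).symm.trans <| (h ▸ coeFn_toL2 g : ⇑(toL2 f) =ᵐ[μ] g)

theorem toL2_eq_iff {f : Lp ℂ ∞ μ} {g : Lp ℂ 2 μ} : toL2 f = g ↔ f =ᵐ[μ] g :=
  ⟨fun h => h ▸ (coeFn_toL2 f).symm, fun h => Lp.ext ((coeFn_toL2 f).trans h)⟩

theorem memLp_top_toL2 (f : Lp ℂ ∞ μ) : MemLp (toL2 f) ∞ μ :=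
  (Lp.memLp f).ae_eq (coeFn_toL2 f).symm

/-- Integration as a linear functional on `L^∞`. -/
def integralₗ (μ : Measure X) [IsFiniteMeasure μ] : Lp ℂ ∞ μ →ₗ[ℂ] ℂ where
  toFun f := ∫ x, f x ∂μ
  map_add' f g := by
    rw [integral_congr_ae (Lp.coeFn_add f g)]
    exact integral_add (integrable f) (integrable g)
  map_smul' c f := by
    rw [integral_congr_ae (Lp.coeFn_smul c f)]
    exact integral_smul c f

theorem integralₗ_apply (f : Lp ℂ ∞ μ) : integralₗ μ f = ∫ x, f x ∂μ := rfl

theorem integralₗ_star_mul_self (f : Lp ℂ ∞ μ) :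
    integralₗ μ (star f * f) = ((‖toL2 f‖ ^ 2 : ℝ) : ℂ) := by
  have h := L2.inner_def (𝕜 := ℂ) (toL2 f) (toL2 f)
  simp only [inner_self_eq_norm_sq_to_K] at h
  rw [integralₗ_apply, Complex.ofReal_pow]
  refine (integral_congr_ae ?_).trans h.symm
  filter_upwards [coeFn_star_mul_self f, coeFn_toL2 f] with x h1 h2
  rw [h1, h2]
  simp

end FiniteMeasure

theorem norm_toL2_le [IsProbabilityMeasure μ] (f : Lp ℂ ∞ μ) : ‖toL2 f‖ ≤ ‖f‖ := by
  rw [Lp.norm_def, Lp.norm_def, eLpNorm_congr_ae (coeFn_toL2 f)]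
  exact ENNReal.toReal_mono (Lp.eLpNorm_ne_top f)
    (eLpNorm_le_eLpNorm_of_exponent_le le_top (Lp.aestronglyMeasurable f))

theorem continuous_toL2 [IsProbabilityMeasure μ] :
    Continuous (toL2 : Lp ℂ ∞ μ →ₗ[ℂ] Lp ℂ 2 μ) :=
  AddMonoidHomClass.continuous_of_bound toL2 1 fun f => by simpa using norm_toL2_le f

end LInfty

/-! ### Extension of a representation of `C(Y)` to `L²` -/

open scoped ComplexOrder in
/-- The Riesz-Markov-Kakutani theorem for complex-valued functions on a compact Hausdorff space. -/
theorem exists_regular_integral_eq_of_nonneg {Y : Type*} [TopologicalSpace Y] [CompactSpace Y]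
    [T2Space Y] [MeasurableSpace Y] [BorelSpace Y] (L : C(Y, ℂ) →ₗ[ℂ] ℂ)
    (hL : ∀ f : C(Y, ℂ), 0 ≤ L (star f * f)) :
    ∃ ν : Measure Y, ν.Regular ∧ IsFiniteMeasure ν ∧ ∀ f : C(Y, ℂ), ∫ y, f y ∂ν = L f := by
  let toC : C(Y, ℝ) →ₗ[ℝ] C(Y, ℂ) :=
    { toFun f := ⟨fun y => (f y : ℂ), by fun_prop⟩
      map_add' f g := by ext; simp
      map_smul' c f := by ext; simp }
  have hpos : ∀ f : C(Y, ℝ), 0 ≤ f → 0 ≤ L (toC f) := fun f hf => by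
    convert hL (toC ⟨fun y => √(f y), by fun_prop⟩) using 2
    ext y
    simp only [toC, LinearMap.coe_mk, AddHom.coe_mk, ContinuousMap.coe_mk, ContinuousMap.mul_apply,
      ContinuousMap.star_apply, RCLike.star_def, Complex.conj_ofReal]
    rw [← Complex.ofReal_mul, Real.mul_self_sqrt (show 0 ≤ f y from hf y)]
  -- a real function is the difference of two nonnegative ones
  have hreal : ∀ f : C(Y, ℝ), ((L (toC f)).re : ℂ) = L (toC f) := fun f => by
    have h1 := (Complex.nonneg_iff.1 (hpos _ (posPart_nonneg f))).2
    have h2 := (Complex.nonneg_iff.1 (hpos _ (negPart_nonneg f))).2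
    have h3 : (L (toC f)).im = 0 := by
      rw [← posPart_sub_negPart f, map_sub, map_sub, Complex.sub_im, ← h1, ← h2, sub_zero]
    exact Complex.ext rfl (by simp [h3])
  let Λ : C_c(Y, ℝ) →ₚ[ℝ] ℝ := PositiveLinearMap.mk₀
    { toFun f := (L (toC f)).re
      map_add' f g := by
        rw [← Complex.add_re, ← map_add, ← map_add]; rfl
      map_smul' c f := by
        have : toC (c • f : C_c(Y, ℝ)) = (c : ℂ) • toC f := by ext; simp [toC]
        rw [this, map_smul, smul_eq_mul, Complex.re_ofReal_mul]; rfl }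
    fun f hf => (Complex.nonneg_iff.1 (hpos f hf)).1
  have hΛ : ∀ f : C(Y, ℝ), ((∫ y, f y ∂(RealRMK.rieszMeasure Λ) : ℝ) : ℂ) = L (toC f) := fun f => by
    rw [← hreal]
    exact congrArg _ (RealRMK.integral_rieszMeasure Λ
      ⟨f, HasCompactSupport.of_compactSpace _⟩)
  refine ⟨RealRMK.rieszMeasure Λ, inferInstance, inferInstance, fun f => ?_⟩
  have hint : Integrable f (RealRMK.rieszMeasure Λ) :=
    (BoundedContinuousFunction.mkOfCompact f).integrable _
  let fr : C(Y, ℝ) := ⟨fun y => (f y).re, by fun_prop⟩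
  let fi : C(Y, ℝ) := ⟨fun y => (f y).im, by fun_prop⟩
  have hf : f = toC fr + Complex.I • toC fi := by
    ext y
    simp [toC, fr, fi, mul_comm Complex.I]
  have h := integral_re_add_im hint
  rw [← h]
  conv_rhs => rw [hf, map_add, map_smul, ← hΛ, ← hΛ, smul_eq_mul, mul_comm]
  rfl

/-- Let `Φ` be a `*`-homomorphism from `C(Y)`, `Y` compact, to `L^∞(μ)` with image dense in
`L²(μ)`. Then the functional `f ↦ ∫ Φ f ∂μ` is given by a regular measure `ν` on `Y`, and `Φ`
extends to a unitary map `L²(ν) → L²(μ)`, as `‖f‖² = ∫ |f|² ∂ν = ∫ Φ (|f|²) ∂μ = ‖Φ f‖²`. -/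
theorem exists_measure_linearIsometryEquiv {X Y : Type*} [MeasurableSpace X] [TopologicalSpace Y]
    [CompactSpace Y] [T2Space Y] [MeasurableSpace Y] [BorelSpace Y] {μ : Measure X}
    [IsProbabilityMeasure μ] (Φ : C(Y, ℂ) →⋆ₐ[ℂ] Lp ℂ ∞ μ)
    (hΦ : DenseRange fun f => LInfty.toL2 (Φ f)) :
    ∃ (ν : Measure Y) (_ : IsProbabilityMeasure ν) (V : Lp ℂ 2 ν ≃ₗᵢ[ℂ] Lp ℂ 2 μ), ν.Regular ∧
      (∀ f : C(Y, ℂ), ∫ y, f y ∂ν = ∫ x, Φ f x ∂μ) ∧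
      ∀ f : C(Y, ℂ), V (ContinuousMap.toLp 2 ν ℂ f) = LInfty.toL2 (Φ f) := by
  let L : C(Y, ℂ) →ₗ[ℂ] ℂ := LInfty.integralₗ μ ∘ₗ Φ.toAlgHom.toLinearMap
  have hL : ∀ f, L (star f * f) = ((‖LInfty.toL2 (Φ f)‖ ^ 2 : ℝ) : ℂ) := fun f => by
    rw [← LInfty.integralₗ_star_mul_self, ← map_star, ← map_mul]; rfl
  obtain ⟨ν, hreg, hfin, hν⟩ := exists_regular_integral_eq_of_nonneg L fun f => by
    rw [hL]; exact Complex.zero_le_real.2 (sq_nonneg _)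
  have hprob : IsProbabilityMeasure ν := by
    have h := hν 1
    have h1 : L 1 = 1 := by
      change LInfty.integralₗ μ (Φ 1) = 1
      rw [map_one, LInfty.integralₗ_apply, integral_congr_ae LInfty.coeFn_one]
      simp
    rw [h1] at h
    simp only [ContinuousMap.one_apply, integral_const, Complex.real_smul, mul_one] at h
    rw [isProbabilityMeasure_iff_real]
    exact_mod_cast h
  have hnorm : ∀ f : C(Y, ℂ), ‖LInfty.toL2 (Φ f)‖ = ‖ContinuousMap.toLp 2 ν ℂ f‖ := fun f => by
    rw [← sq_eq_sq₀ (norm_nonneg _) (norm_nonneg _), ← Complex.ofReal_inj, ← hL, ← hν]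
    have h := L2.inner_def (𝕜 := ℂ) (ContinuousMap.toLp 2 ν ℂ f) (ContinuousMap.toLp 2 ν ℂ f)
    simp only [inner_self_eq_norm_sq_to_K] at h
    refine Eq.trans (integral_congr_ae ?_) (h.symm.trans (by norm_cast))
    filter_upwards [ContinuousMap.coeFn_toLp (p := 2) (𝕜 := ℂ) ν f] with y hy
    rw [hy]
    simp [Complex.conj_mul']
  refine ⟨ν, hprob, (LinearEquiv.refl ℂ C(Y, ℂ)).extendOfIsometry
    (ContinuousMap.toLp 2 ν ℂ : C(Y, ℂ) →L[ℂ] Lp ℂ 2 ν).toLinearMap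
    (LInfty.toL2 ∘ₗ Φ.toAlgHom.toLinearMap) (ContinuousMap.toLp_denseRange ℂ ν ℂ (by simp)) hΦ
    hnorm, hreg, hν, fun f => ?_⟩
  exact LinearEquiv.extendOfIsometry_eq ..

/-! ### Multiplicative operators on `L²` -/

/-- If `W f * W g = W (f * g)` holds, for a fixed bounded `g`, for all bounded `f` in a dense set,
then it holds for all bounded `f`. The functions `W f` and `W g` need not be known to be bounded:
the identity passes to limits in `L²`, which are limits almost everywhere of subsequences. -/
theorem map_mul_of_dense {X X' : Type*} [MeasurableSpace X] [MeasurableSpace X'] {μ : Measure X}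
    {μ' : Measure X'} (W : Lp ℂ 2 μ →L[ℂ] Lp ℂ 2 μ') {D : Set (Lp ℂ 2 μ)} (hD : Dense D)
    {g : Lp ℂ 2 μ} (hg : MemLp g ∞ μ)
    (hW : ∀ f ∈ D, ∀ h : Lp ℂ 2 μ, h =ᵐ[μ] f * g → W h =ᵐ[μ'] W f * W g)
    (f h : Lp ℂ 2 μ) (hh : h =ᵐ[μ] f * g) : W h =ᵐ[μ'] W f * W g := by
  have hmem : ∀ f : Lp ℂ 2 μ, MemLp (⇑f * ⇑g) 2 μ := fun f => hg.mul (Lp.memLp f)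
  let M : Lp ℂ 2 μ →L[ℂ] Lp ℂ 2 μ := LinearMap.mkContinuous
    { toFun f := (hmem f).toLp _
      map_add' f₁ f₂ := by
        rw [← MemLp.toLp_add]
        refine MemLp.toLp_congr _ _ ?_
        filter_upwards [Lp.coeFn_add f₁ f₂] with x hx
        simp only [Pi.mul_apply, hx, Pi.add_apply, add_mul]
      map_smul' c f := by
        rw [RingHom.id_apply, ← MemLp.toLp_const_smul]
        refine MemLp.toLp_congr _ _ ?_
        filter_upwards [Lp.coeFn_smul c f] with x hx
        simp only [Pi.mul_apply, hx, Pi.smul_apply, smul_eq_mul, mul_assoc] }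
    ‖hg.toLp _‖ fun f => by
      refine Lp.norm_le_mul_norm_of_ae_le_mul ?_
      filter_upwards [(hmem f).coeFn_toLp, LInfty.ae_norm_le (hg.toLp _), hg.coeFn_toLp]
        with x h1 h2 h3
      rw [h3] at h2
      simp only [LinearMap.coe_mk, AddHom.coe_mk]
      rw [h1, Pi.mul_apply, norm_mul, mul_comm]
      gcongr
  have hM : ∀ f, M f =ᵐ[μ] ⇑f * ⇑g := fun f => (hmem f).coeFn_toLp
  obtain ⟨u, huD, hu⟩ := mem_closure_iff_seq_limit.1 (hD f)
  have hWu : Tendsto (fun n => W (u n)) atTop (𝓝 (W f)) := (W.continuous.tendsto _).comp hu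
  have hWM : Tendsto (fun n => W (M (u n))) atTop (𝓝 (W (M f))) :=
    ((W.comp M).continuous.tendsto _).comp hu
  obtain ⟨s, hs, hs'⟩ := (tendstoInMeasure_of_tendsto_Lp hWu).exists_seq_tendsto_ae
  obtain ⟨r, hr, hr'⟩ :=
    (tendstoInMeasure_of_tendsto_Lp (hWM.comp hs.tendsto_atTop)).exists_seq_tendsto_ae
  have hMf : h = M f := Lp.ext (hh.trans (hM f).symm)
  have hae : ∀ᵐ x ∂μ', ∀ n, W (M (u n)) x = W (u n) x * W g x :=
    ae_all_iff.2 fun n => hW (u n) (huD n) _ (hM _)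
  filter_upwards [hae, hs', hr'] with x h1 h2 h3
  rw [hMf, Pi.mul_apply]
  refine tendsto_nhds_unique h3 ?_
  simp only [Function.comp_apply, h1]
  exact (h2.comp hr.tendsto_atTop).mul_const _

/-- A continuous linear map on `L²` that is multiplicative on a dense set of bounded functions is
multiplicative on all bounded functions. -/
theorem map_mul_of_dense_of_bounded {X X' : Type*} [MeasurableSpace X] [MeasurableSpace X']
    {μ : Measure X} {μ' : Measure X'} (W : Lp ℂ 2 μ →L[ℂ] Lp ℂ 2 μ') {D : Set (Lp ℂ 2 μ)}
    (hD : Dense D) (hDb : ∀ f ∈ D, MemLp f ∞ μ)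
    (hW : ∀ f ∈ D, ∀ g ∈ D, ∀ h : Lp ℂ 2 μ, h =ᵐ[μ] f * g → W h =ᵐ[μ'] W f * W g)
    (f g h : Lp ℂ 2 μ) (hg : MemLp g ∞ μ) (hh : h =ᵐ[μ] f * g) :
    W h =ᵐ[μ'] W f * W g := by
  refine map_mul_of_dense W hD hg (fun f hf h hh => ?_) f h hh
  rw [mul_comm] at hh ⊢
  refine map_mul_of_dense W hD (hDb f hf) (fun g hg h hh => ?_) g h hh
  rw [mul_comm] at hh ⊢
  exact hW f hf g hg h hh

section Extension

variable {X Y : Type*} [MeasurableSpace X] [TopologicalSpace Y] [CompactSpace Y]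
  [MeasurableSpace Y] [BorelSpace Y] {μ : Measure X} [IsProbabilityMeasure μ] {ν : Measure Y}
  [IsProbabilityMeasure ν] {Φ : C(Y, ℂ) →⋆ₐ[ℂ] Lp ℂ ∞ μ} {V : Lp ℂ 2 ν ≃ₗᵢ[ℂ] Lp ℂ 2 μ}

theorem toLp_mul_eq_of_ae_eq {a b : C(Y, ℂ)} {h : Lp ℂ 2 ν}
    (hh : h =ᵐ[ν] ContinuousMap.toLp 2 ν ℂ a * ContinuousMap.toLp 2 ν ℂ b) :
    h = ContinuousMap.toLp 2 ν ℂ (a * b) := by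
  refine Lp.ext (hh.trans ?_)
  filter_upwards [ContinuousMap.coeFn_toLp (p := 2) (𝕜 := ℂ) ν a,
    ContinuousMap.coeFn_toLp (p := 2) (𝕜 := ℂ) ν b,
    ContinuousMap.coeFn_toLp (p := 2) (𝕜 := ℂ) ν (a * b)] with x h1 h2 h3
  rw [Pi.mul_apply, h1, h2, h3, ContinuousMap.mul_apply]

theorem toL2_mul_eq_of_ae_eq {a b : Lp ℂ ∞ μ} {h : Lp ℂ 2 μ}
    (hh : h =ᵐ[μ] LInfty.toL2 a * LInfty.toL2 b) : h = LInfty.toL2 (a * b) := by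
  refine Lp.ext (hh.trans ?_)
  filter_upwards [LInfty.coeFn_toL2 a, LInfty.coeFn_toL2 b, LInfty.coeFn_toL2 (a * b),
    LInfty.coeFn_mul a b] with x h1 h2 h3 h4
  rw [Pi.mul_apply, h1, h2, h3, h4, Pi.mul_apply]

/-- The extension `V` of a homomorphism `Φ : C(Y) → L^∞` is multiplicative on bounded functions. -/
theorem map_mul_of_map_toLp [ν.WeaklyRegular] [NormalSpace Y]
    (hV : ∀ f : C(Y, ℂ), V (ContinuousMap.toLp 2 ν ℂ f) = LInfty.toL2 (Φ f))
    (f g h : Lp ℂ 2 ν) (hg : MemLp g ∞ ν) (hh : h =ᵐ[ν] f * g) :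
    V h =ᵐ[μ] V f * V g := by
  refine map_mul_of_dense_of_bounded (V : Lp ℂ 2 ν →L[ℂ] Lp ℂ 2 μ)
    (ContinuousMap.toLp_denseRange ℂ ν ℂ (by simp)) ?_ ?_ f g h hg hh
  · rintro _ ⟨a, rfl⟩
    refine MemLp.ae_eq (ContinuousMap.coeFn_toLp ν a).symm ?_
    exact memLp_top_of_bound a.continuous.aestronglyMeasurable ‖a‖
      (.of_forall fun y => a.norm_coe_le_norm y)
  · rintro _ ⟨a, rfl⟩ _ ⟨b, rfl⟩ h hh
    obtain rfl := toLp_mul_eq_of_ae_eq hh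
    change V (ContinuousMap.toLp 2 ν ℂ (a * b)) =ᵐ[μ]
      V (ContinuousMap.toLp 2 ν ℂ a) * V (ContinuousMap.toLp 2 ν ℂ b)
    rw [hV, hV, hV, map_mul]
    filter_upwards [LInfty.coeFn_toL2 (Φ a), LInfty.coeFn_toL2 (Φ b),
      LInfty.coeFn_toL2 (Φ a * Φ b), LInfty.coeFn_mul (Φ a) (Φ b)] with x h1 h2 h3 h4
    rw [h3, h4, Pi.mul_apply, Pi.mul_apply, h1, h2]

/-- The inverse of `V` is multiplicative on bounded functions, as the image of `Φ` is a dense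
subalgebra. -/
theorem symm_map_mul_of_map_toLp (hΦ : DenseRange fun f => LInfty.toL2 (Φ f))
    (hV : ∀ f : C(Y, ℂ), V (ContinuousMap.toLp 2 ν ℂ f) = LInfty.toL2 (Φ f))
    (f g h : Lp ℂ 2 μ) (hg : MemLp g ∞ μ) (hh : h =ᵐ[μ] f * g) :
    V.symm h =ᵐ[ν] V.symm f * V.symm g := by
  have hV' : ∀ f, V.symm (LInfty.toL2 (Φ f)) = ContinuousMap.toLp 2 ν ℂ f := fun f => by
    rw [← hV, V.symm_apply_apply]
  refine map_mul_of_dense_of_bounded (V.symm : Lp ℂ 2 μ →L[ℂ] Lp ℂ 2 ν) hΦ ?_ ?_ f g h hg hh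
  · rintro _ ⟨a, rfl⟩
    exact LInfty.memLp_top_toL2 _
  · rintro _ ⟨a, rfl⟩ _ ⟨b, rfl⟩ h hh
    obtain rfl := toL2_mul_eq_of_ae_eq hh
    change V.symm (LInfty.toL2 (Φ a * Φ b)) =ᵐ[ν]
      V.symm (LInfty.toL2 (Φ a)) * V.symm (LInfty.toL2 (Φ b))
    rw [← map_mul, hV', hV', hV']
    filter_upwards [ContinuousMap.coeFn_toLp (p := 2) (𝕜 := ℂ) ν a,
      ContinuousMap.coeFn_toLp (p := 2) (𝕜 := ℂ) ν b,
      ContinuousMap.coeFn_toLp (p := 2) (𝕜 := ℂ) ν (a * b)] with x h1 h2 h3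
    rw [Pi.mul_apply, h1, h2, h3, ContinuousMap.mul_apply]

end Extension

/-! ### Continuity on `C_c(G)` -/

section CompactSupport

open CompactlySupportedContinuousMap

variable {G : Type*} [TopologicalSpace G]

/-- The Banach space `C_K(G)`, encoded as the bounded continuous functions vanishing off `K`. -/
def boundedVanishingOff (K : Set G) : Submodule ℂ (BoundedContinuousFunction G ℂ) where
  carrier := {f | ∀ s ∉ K, f s = 0}
  add_mem' hf hg s hs := by simp [hf s hs, hg s hs]
  zero_mem' _ _ := rfl
  smul_mem' c f hf s hs := by simp [hf s hs]

theorem isClosed_boundedVanishingOff (K : Set G) :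
    IsClosed (boundedVanishingOff K : Set (BoundedContinuousFunction G ℂ)) := by
  have : (boundedVanishingOff K : Set (BoundedContinuousFunction G ℂ)) =
      ⋂ s ∈ Kᶜ, {f | f s = 0} := by
    ext f
    simp only [Set.mem_iInter]
    rfl
  rw [this]
  exact isClosed_biInter fun s _ => isClosed_eq (by fun_prop) continuous_const

/-- A form of the closed graph theorem for `C_c(G)`: a linear map to a Banach space is continuous
if it is so after composition with some continuous injection. It holds on each Banach space
`C_K(G)`, hence on the inductive limit. -/
theorem continuous_cc_of_comp_injective [T2Space G] {E F : Type*} [NormedAddCommGroup E]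
    [NormedSpace ℂ E] [CompleteSpace E] [TopologicalSpace F] [T2Space F]
    (N : C_c(G, ℂ) →ₗ[ℂ] E) {T : E → F} (hT : Continuous T) (hinj : Function.Injective T)
    (hTN : Continuous (T ∘ N)) : Continuous N := by
  refine (continuous_cc_iff N).2 fun K hK => ?_
  have : CompleteSpace (boundedVanishingOff K) :=
    (isClosed_boundedVanishingOff K).completeSpace_coe
  let j : boundedVanishingOff K →ₗ[ℂ] C_c(G, ℂ) :=
    { toFun f := ⟨f.1.toContinuousMap, HasCompactSupport.intro hK fun s hs => f.2 s hs⟩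
      map_add' _ _ := rfl
      map_smul' _ _ := rfl }
  have hj : Continuous j := by
    let j' : boundedVanishingOff K → {φ : C_c(G, ℂ) // tsupport φ ⊆ K} := fun f =>
      ⟨j f, closure_minimal (fun s hs => not_not.1 fun h => hs (f.2 s h)) hK.isClosed⟩
    have hj' : Continuous[_, supNormTopologyOn K] j' :=
      continuous_induced_rng.2 continuous_subtype_val
    exact @Continuous.comp _ _ _ _ (supNormTopologyOn K) _ _ _ (continuous_ccInclusion hK) hj'
  have hNj : Continuous (N ∘ₗ j) := by
    refine LinearMap.continuous_of_seq_closed_graph _ fun u f y hu hy => hinj ?_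
    exact tendsto_nhds_unique ((hT.tendsto _).comp hy) (((hTN.comp hj).tendsto _).comp hu)
  let i : {φ : C_c(G, ℂ) // tsupport φ ⊆ K} → boundedVanishingOff K := fun φ =>
    ⟨toBoundedContinuousFunction φ.1, fun s hs =>
      image_eq_zero_of_notMem_tsupport fun h => hs (φ.2 h)⟩
  have hi : Continuous[supNormTopologyOn K, _] i :=
    continuous_induced_rng.2 continuous_induced_dom
  exact @Continuous.comp _ _ _ (supNormTopologyOn K) _ _ i (N ∘ₗ j) hNj hi

variable [AddCommGroup G] [IsTopologicalAddGroup G]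

theorem ccTranslate_zero (φ : C_c(G, ℂ)) : ccTranslate 0 φ = φ := by
  ext s
  simp [ccTranslate_apply]

theorem ccTranslate_add (s t : G) (φ : C_c(G, ℂ)) :
    ccTranslate (s + t) φ = ccTranslate s (ccTranslate t φ) := by
  ext r
  simp [ccTranslate_apply, sub_sub]

open scoped Pointwise in
theorem continuous_ccTranslate [T2Space G] [LocallyCompactSpace G] (φ : C_c(G, ℂ)) :
    Continuous fun t => ccTranslate t φ := by
  refine continuous_iff_continuousAt.2 fun t₀ => ?_
  obtain ⟨V, hV, hV₀⟩ := exists_compact_mem_nhds t₀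
  -- all translates by elements of `V` are supported in the compact set `K`
  set K : Set G := tsupport φ + V
  have hK : IsCompact K := IsCompact.add φ.hasCompactSupport hV
  have hoff : ∀ t ∈ V, ∀ s ∉ K, ccTranslate t φ s = 0 := fun t ht s hs =>
    image_eq_zero_of_notMem_tsupport (f := φ) fun h => hs ⟨s - t, h, t, ht, sub_add_cancel s t⟩
  let j : V → {φ : C_c(G, ℂ) // tsupport φ ⊆ K} := fun t => ⟨ccTranslate t φ,
    closure_minimal (fun s hs => not_not.1 fun h => hs (hoff t t.2 s h)) hK.isClosed⟩
  have : CompactSpace K := isCompact_iff_compactSpace.1 hK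
  let c : C(V, C(K, ℂ)) := ContinuousMap.curry
    ⟨fun p : V × K => φ ((p.2 : G) - (p.1 : G)), by fun_prop⟩
  have hj : Continuous[_, supNormTopologyOn K] j := by
    refine continuous_induced_rng.2 (continuous_iff_continuousAt.2 fun t => ?_)
    refine tendsto_iff_dist_tendsto_zero.2 ?_
    refine squeeze_zero (fun _ => dist_nonneg) (fun t' => ?_)
      (tendsto_iff_dist_tendsto_zero.1 (c.continuous.tendsto t))
    refine (BoundedContinuousFunction.dist_le dist_nonneg).2 fun s => ?_
    by_cases hs : s ∈ K
    · exact ContinuousMap.dist_apply_le_dist (f := c t') (g := c t) ⟨s, hs⟩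
    · change dist (ccTranslate (t' : G) φ s) (ccTranslate (t : G) φ s) ≤ _
      rw [hoff _ t'.2 s hs, hoff _ t.2 s hs, dist_self]
      exact dist_nonneg
  have h : ContinuousOn (fun t => ccTranslate t φ) V := continuousOn_iff_continuous_domRestrict.2
    (@Continuous.comp _ _ _ _ (supNormTopologyOn K) _ _ _ (continuous_ccInclusion hK) hj)
  exact h.continuousAt hV₀

end CompactSupport

/-! ### Functional calculus and measure preserving maps on `L^∞` -/

namespace LInfty

variable {X : Type*} [MeasurableSpace X] {μ : Measure X}

theorem coeFn_prod {ι : Type*} (s : Finset ι) (f : ι → Lp ℂ ∞ μ) :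
    ⇑(∏ i ∈ s, f i) =ᵐ[μ] fun x => ∏ i ∈ s, f i x := by
  classical
  induction s using Finset.induction_on with
  | empty => exact coeFn_one
  | insert i s hi ih =>
    rw [Finset.prod_insert hi]
    filter_upwards [coeFn_mul (f i) (∏ i ∈ s, f i), ih] with x h1 h2
    rw [h1, Pi.mul_apply, h2, Finset.prod_insert hi]

/-- Composition with a measure preserving map as a `*`-homomorphism on `L^∞`. -/
def compMeasurePreserving (f : X → X) (hf : MeasurePreserving f μ μ) :
    Lp ℂ ∞ μ →⋆ₐ[ℂ] Lp ℂ ∞ μ where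
  toFun := Lp.compMeasurePreserving f hf
  map_one' := rfl
  map_mul' g h := by rcases g with ⟨⟨_⟩, _⟩; rcases h with ⟨⟨_⟩, _⟩; rfl
  map_zero' := map_zero _
  map_add' := map_add _
  commutes' c := by
    rw [Algebra.algebraMap_eq_smul_one]
    exact (Lp.compMeasurePreservingₗ ℂ f hf).map_smul c 1
  map_star' g := by rcases g with ⟨⟨_⟩, _⟩; rfl

theorem coeFn_compMeasurePreserving {f : X → X} (hf : MeasurePreserving f μ μ) (g : Lp ℂ ∞ μ) :
    ⇑(compMeasurePreserving f hf g) =ᵐ[μ] g ∘ f :=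
  Lp.coeFn_compMeasurePreserving g hf

theorem continuous_compMeasurePreserving {f : X → X} (hf : MeasurePreserving f μ μ) :
    Continuous (compMeasurePreserving f hf) :=
  (Lp.isometry_compMeasurePreserving hf).continuous

/-- The closed `*`-subalgebras of `L^∞` are stable under the continuous functional calculus: by the
Stone-Weierstrass theorem, on the range of `g` the function `ϑ` is a uniform limit of polynomials
in `z` and its conjugate. -/
theorem exists_mem_ae_eq_comp {A : StarSubalgebra ℂ (Lp ℂ ∞ μ)}
    (hA : IsClosed (A : Set (Lp ℂ ∞ μ))) {g : Lp ℂ ∞ μ} (hg : g ∈ A) (ϑ : C(ℂ, ℂ)) :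
    ∃ h ∈ A, h =ᵐ[μ] fun x => ϑ (g x) := by
  set K : Set ℂ := Metric.closedBall 0 ‖g‖
  have hgK : ∀ᵐ x ∂μ, g x ∈ K := (ae_norm_le g).mono fun x hx => by simpa [K] using hx
  have : CompactSpace K := isCompact_iff_compactSpace.1 (isCompact_closedBall _ _)
  suffices H : ∀ f : C(K, ℂ), ∃ h ∈ A, ∀ᵐ x ∂μ, ∀ hx : g x ∈ K, h x = f ⟨g x, hx⟩ by
    obtain ⟨h, hhA, hh⟩ := H (ϑ.restrict K)
    refine ⟨h, hhA, ?_⟩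
    filter_upwards [hh, hgK] with x h1 h2 using h1 h2
  intro f
  induction f using ContinuousMap.induction_on_of_compact with
  | const r =>
    refine ⟨r • 1, A.smul_mem A.one_mem r, ?_⟩
    filter_upwards [Lp.coeFn_smul r (1 : Lp ℂ ∞ μ), coeFn_one (μ := μ)] with x h1 h2 hx
    simp [h1, h2]
  | id => exact ⟨g, hg, .of_forall fun x hx => rfl⟩
  | star_id =>
    refine ⟨star g, star_mem hg, ?_⟩
    filter_upwards [Lp.coeFn_star g] with x h1 hx
    rw [h1]
    rfl
  | add f₁ f₂ h₁ h₂ =>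
    obtain ⟨a, ha, ha'⟩ := h₁
    obtain ⟨b, hb, hb'⟩ := h₂
    refine ⟨a + b, add_mem ha hb, ?_⟩
    filter_upwards [Lp.coeFn_add a b, ha', hb'] with x h1 h2 h3 hx
    rw [h1, Pi.add_apply, h2 hx, h3 hx, ContinuousMap.add_apply]
  | mul f₁ f₂ h₁ h₂ =>
    obtain ⟨a, ha, ha'⟩ := h₁
    obtain ⟨b, hb, hb'⟩ := h₂
    refine ⟨a * b, mul_mem ha hb, ?_⟩
    filter_upwards [coeFn_mul a b, ha', hb'] with x h1 h2 h3 hx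
    rw [h1, Pi.mul_apply, h2 hx, h3 hx, ContinuousMap.mul_apply]
  | frequently f hf =>
    obtain ⟨F, hF⟩ := ContinuousMap.exists_restrict_eq Metric.isClosed_closedBall f
    have hFf : ∀ x, ∀ hx : g x ∈ K, F (g x) = f ⟨g x, hx⟩ := fun x hx => by rw [← hF]; rfl
    have hmem : MemLp (fun x => F (g x)) ∞ μ := by
      refine memLp_top_of_bound (F.continuous.comp_aestronglyMeasurable
        (Lp.aestronglyMeasurable g)) ‖f‖ ?_
      filter_upwards [hgK] with x hx
      rw [hFf x hx]
      exact f.norm_coe_le_norm _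
    refine ⟨hmem.toLp _, ?_, ?_⟩
    · refine hA.closure_subset (Metric.mem_closure_iff.2 fun ε hε => ?_)
      obtain ⟨f', ⟨h, hhA, hh⟩, hf'⟩ := (hf.and_eventually (Metric.ball_mem_nhds f hε)).exists
      refine ⟨h, hhA, lt_of_le_of_lt ?_ (Metric.mem_ball'.1 hf')⟩
      rw [dist_eq_norm]
      refine norm_le_of_ae_bound _ dist_nonneg ?_
      filter_upwards [Lp.coeFn_sub (hmem.toLp _) h, hmem.coeFn_toLp, hh, hgK] with x h1 h2 h3 hx
      rw [h1, Pi.sub_apply, h2, h3 hx, hFf x hx, ← dist_eq_norm]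
      exact ContinuousMap.dist_apply_le_dist _
    · filter_upwards [hmem.coeFn_toLp] with x h1 hx
      rw [h1, hFf x hx]

end LInfty

/-! ### The algebra of a spatial process -/

namespace SpatialProcess

variable {G X : Type*} [AddCommGroup G] [TopologicalSpace G] [IsTopologicalAddGroup G]
  [MeasurableSpace G] [MeasurableSpace X] (P : SpatialProcess G X)

instance : IsProbabilityMeasure P.m := P.isProbabilityMeasure

theorem isClosed_algebra : IsClosed (P.algebra : Set (Lp ℂ ∞ P.m)) :=
  StarSubalgebra.isClosed_topologicalClosure _

attribute [local instance] isClosed_algebra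

theorem algebra_le {S : StarSubalgebra ℂ (Lp ℂ ∞ P.m)} (hS : IsClosed (S : Set (Lp ℂ ∞ P.m)))
    (h : ∀ f : Lp ℂ ∞ P.m, (∃ φ, f =ᵐ[P.m] P.N φ) → f ∈ S) : P.algebra ≤ S :=
  StarSubalgebra.topologicalClosure_minimal (StarAlgebra.adjoin_le fun f hf => h f hf) hS

/-- The Koopman operator `T_t` on `P.algebra`, which is invariant as `T_t (N φ) = N (τ_t φ)`. -/
def koopmanAlgebra (t : G) : P.algebra →⋆ₐ[ℂ] P.algebra :=
  ((LInfty.compMeasurePreserving _ (P.measurePreserving (-t))).comp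
    P.algebra.subtype).codRestrict P.algebra fun a => by
      have hle : P.algebra ≤ P.algebra.comap
          (LInfty.compMeasurePreserving _ (P.measurePreserving (-t))) := by
        refine P.algebra_le (P.isClosed_algebra.preimage
          (LInfty.continuous_compMeasurePreserving _)) ?_
        rintro f ⟨φ, hf⟩
        refine StarSubalgebra.le_topologicalClosure _ (StarAlgebra.subset_adjoin ℂ _
          ⟨ccTranslate t φ, ?_⟩)
        rw [← P.koopman_N]
        refine (LInfty.coeFn_compMeasurePreserving _ f).trans ?_
        refine ((P.measurePreserving (-t)).quasiMeasurePreserving.ae_eq_comp hf).trans ?_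
        exact (Lp.coeFn_compMeasurePreserving (P.N φ) (P.measurePreserving (-t))).symm
      exact hle a.2

theorem coeFn_koopmanAlgebra (t : G) (a : P.algebra) :
    ⇑(P.koopmanAlgebra t a : Lp ℂ ∞ P.m) =ᵐ[P.m] (a : Lp ℂ ∞ P.m) ∘ P.act (-t) :=
  LInfty.coeFn_compMeasurePreserving _ _

theorem toL2_koopmanAlgebra (t : G) (a : P.algebra) :
    LInfty.toL2 (P.koopmanAlgebra t a : Lp ℂ ∞ P.m) = P.koopman t (LInfty.toL2 a) := by
  rw [LInfty.toL2_eq_iff]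
  refine (P.coeFn_koopmanAlgebra t a).trans ?_
  refine EventuallyEq.trans ?_
    (Lp.coeFn_compMeasurePreserving (LInfty.toL2 (a : Lp ℂ ∞ P.m)) _).symm
  exact (P.measurePreserving (-t)).quasiMeasurePreserving.ae_eq_comp (LInfty.coeFn_toL2 _).symm

theorem integral_koopmanAlgebra (t : G) (a : P.algebra) :
    ∫ x, (P.koopmanAlgebra t a : Lp ℂ ∞ P.m) x ∂P.m = ∫ x, (a : Lp ℂ ∞ P.m) x ∂P.m := by
  rw [integral_congr_ae (P.coeFn_koopmanAlgebra t a)]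
  have hmp := P.measurePreserving (-t)
  have h := integral_map (μ := P.m) hmp.measurable.aemeasurable
    (f := (a : Lp ℂ ∞ P.m)) (by rw [hmp.map_eq]; exact Lp.aestronglyMeasurable _)
  rw [hmp.map_eq] at h
  exact h.symm

/-- For a full process, `P.algebra` is dense in `L²`, as it contains all `ϑ(N φ)`. -/
theorem dense_toL2_algebra (hfull : P.IsFull) (hP : ∀ φ, MemLp (P.N φ) ∞ P.m) :
    Dense ((fun a => LInfty.toL2 a) '' (P.algebra : Set (Lp ℂ ∞ P.m))) := by
  refine hfull.mono ?_
  refine Submodule.span_le (p := P.algebra.toSubalgebra.toSubmodule.map LInfty.toL2).2 ?_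
  rintro h ⟨n, ϑ, φ, hh⟩
  have key : ∀ j, ∃ a ∈ P.algebra, a =ᵐ[P.m] fun x => ϑ j (P.N (φ j) x) := fun j => by
    obtain ⟨a, ha, ha'⟩ := LInfty.exists_mem_ae_eq_comp P.isClosed_algebra
      (P.algebraN hP (φ j)).2 (ϑ j : C(ℂ, ℂ))
    refine ⟨a, ha, ha'.trans ?_⟩
    filter_upwards [(hP (φ j)).coeFn_toLp] with x hx
    change ϑ j ((hP (φ j)).toLp _ x) = _
    rw [hx]
  choose a ha ha' using key
  have hmem : ∏ j, a j ∈ P.algebra := prod_mem fun j _ => ha j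
  refine ⟨∏ j, a j, hmem, ?_⟩
  rw [LInfty.toL2_eq_iff]
  refine (LInfty.coeFn_prod _ _).trans (EventuallyEq.trans ?_ hh.symm)
  filter_upwards [ae_all_iff.2 ha'] with x hx
  exact Finset.prod_congr rfl fun j _ => hx j

/-! ### Characters as measures -/

variable [T2Space G]

/-- `N` as a map to `P.algebra`, which is continuous by the closed graph theorem. -/
def algebraNL (hP : ∀ φ, MemLp (P.N φ) ∞ P.m) : C_c(G, ℂ) →L[ℂ] P.algebra :=
  have hN : ∀ φ, LInfty.toL2 (P.algebraN hP φ : Lp ℂ ∞ P.m) = P.N φ := fun φ =>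
    LInfty.toL2_eq_iff.2 (hP φ).coeFn_toLp
  let N' : C_c(G, ℂ) →ₗ[ℂ] P.algebra :=
    { toFun := P.algebraN hP
      map_add' φ ψ := Subtype.ext <| LInfty.toL2_injective <| by
        rw [hN, map_add, ← hN φ, ← hN ψ, ← map_add]; rfl
      map_smul' c φ := Subtype.ext <| LInfty.toL2_injective <| by
        rw [hN, map_smul, ← hN φ, ← map_smul]; rfl }
  { N' with
    cont := by
      refine continuous_cc_of_comp_injective N'
        (T := fun a => LInfty.toL2 (a : Lp ℂ ∞ P.m))
        (LInfty.continuous_toL2.comp continuous_subtype_val)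
        (LInfty.toL2_injective.comp Subtype.val_injective) ?_
      have : (fun a : P.algebra => LInfty.toL2 (a : Lp ℂ ∞ P.m)) ∘ N' = P.N := funext hN
      rw [this]
      exact P.N.continuous }

variable (hP : ∀ φ, MemLp (P.N φ) ∞ P.m)

theorem koopmanAlgebra_algebraNL (t : G) (φ : C_c(G, ℂ)) :
    P.koopmanAlgebra t (P.algebraNL hP φ) = P.algebraNL hP (ccTranslate t φ) := by
  have hN : ∀ φ, LInfty.toL2 (P.algebraNL hP φ : Lp ℂ ∞ P.m) = P.N φ := fun φ =>
    LInfty.toL2_eq_iff.2 (hP φ).coeFn_toLp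
  refine Subtype.ext <| LInfty.toL2_injective ?_
  rw [toL2_koopmanAlgebra, hN, hN, P.koopman_N]

/-- The measure `φ ↦ x (N φ)` on `G` given by a character `x` of `P.algebra`. -/
def toMeasure (x : WeakDual.characterSpace ℂ P.algebra) : MeasuresOn G :=
  StrongDual.toWeakDual ((WeakDual.CharacterSpace.toCLM x).comp (P.algebraNL hP))

theorem toMeasure_apply (x : WeakDual.characterSpace ℂ P.algebra) (φ : C_c(G, ℂ)) :
    P.toMeasure hP x φ = x (P.algebraNL hP φ) := rfl

theorem continuous_toMeasure : Continuous (P.toMeasure hP) :=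
  WeakDual.continuous_of_continuous_eval fun φ =>
    (WeakDual.eval_continuous (P.algebraNL hP φ)).comp continuous_subtype_val

theorem toMeasure_injective : Function.Injective (P.toMeasure hP) := fun x y hxy => by
  have hclosed : IsClosed ((StarAlgHom.equalizer x y).map P.algebra.subtype :
      Set (Lp ℂ ∞ P.m)) :=
    P.isClosed_algebra.isClosedEmbedding_subtypeVal.isClosedMap _
      (isClosed_eq (map_continuous x) (map_continuous y))
  refine DFunLike.ext _ _ fun a => ?_
  obtain ⟨b, hb, hba⟩ := P.algebra_le hclosed
    (fun f ⟨φ, hf⟩ => ⟨P.algebraNL hP φ, DFunLike.congr_fun hxy φ,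
      Lp.ext ((hP φ).coeFn_toLp.trans hf.symm)⟩) a.2
  exact Subtype.ext hba ▸ hb

theorem algebraNL_star (φ : C_c(G, ℂ)) :
    P.algebraNL hP (star φ) = star (P.algebraNL hP φ) := by
  refine Subtype.ext (Lp.ext ?_)
  change ⇑((hP (star φ)).toLp _) =ᵐ[P.m] ⇑(star ((hP φ).toLp _))
  filter_upwards [(hP (star φ)).coeFn_toLp, Lp.coeFn_star ((hP φ).toLp _), (hP φ).coeFn_toLp,
    Lp.coeFn_star (P.N φ)] with x h1 h2 h3 h4
  rw [h1, h2, P.N_star, h4, Pi.star_apply, Pi.star_apply, h3]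

theorem toMeasure_star (x : WeakDual.characterSpace ℂ P.algebra) (φ : C_c(G, ℂ)) :
    P.toMeasure hP x (star φ) = star (P.toMeasure hP x φ) := by
  rw [toMeasure_apply, toMeasure_apply, algebraNL_star, map_star]

/-- The action on characters dual to the Koopman operator `T_t`. -/
def koopmanSpectrum (t : G) (x : WeakDual.characterSpace ℂ P.algebra) :
    WeakDual.characterSpace ℂ P.algebra :=
  WeakDual.CharacterSpace.compContinuousMap (P.koopmanAlgebra t) x

omit [T2Space G] in
theorem koopmanSpectrum_apply (t : G) (x : WeakDual.characterSpace ℂ P.algebra)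
    (a : P.algebra) : P.koopmanSpectrum t x a = x (P.koopmanAlgebra t a) := rfl

/-- `α_t` acts on measures given by characters through the Koopman operator. -/
theorem shift_toMeasure (t : G) (x : WeakDual.characterSpace ℂ P.algebra) :
    MeasuresOn.shift t (P.toMeasure hP x) =
      P.toMeasure hP (P.koopmanSpectrum (-t) x) := by
  refine DFunLike.ext _ _ fun φ => ?_
  rw [MeasuresOn.shift_apply, toMeasure_apply, toMeasure_apply, ← koopmanAlgebra_algebraNL,
    koopmanSpectrum_apply]

/-- The Gelfand spectrum of `P.algebra` is homeomorphic to the set of measures it gives. -/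
def spectrumHomeomorph :
    WeakDual.characterSpace ℂ P.algebra ≃ₜ Set.range (P.toMeasure hP) :=
  Continuous.homeoOfEquivCompactToT2 (f := Equiv.ofInjective _ (P.toMeasure_injective hP))
    ((P.continuous_toMeasure hP).subtype_mk _)

/-! ### The dynamical system on the spectrum -/

instance : CompactSpace (Set.range (P.toMeasure hP)) :=
  (P.spectrumHomeomorph hP).compactSpace

/-- The Gelfand isomorphism `C(Y) ≃ C(Â) ≃ A` for `A = P.algebra`, where the spectrum `Â` is
identified with the set `Y` of measures it gives. -/
def ofContinuousMap : C(Set.range (P.toMeasure hP), ℂ) →⋆ₐ[ℂ] P.algebra :=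
  ((gelfandStarTransform P.algebra).symm :
    C(WeakDual.characterSpace ℂ P.algebra, ℂ) →⋆ₐ[ℂ] P.algebra).comp
    (ContinuousMap.compStarAlgHom' ℂ ℂ (P.spectrumHomeomorph hP :
      C(WeakDual.characterSpace ℂ P.algebra, Set.range (P.toMeasure hP))))

theorem apply_ofContinuousMap (f : C(Set.range (P.toMeasure hP), ℂ))
    (x : WeakDual.characterSpace ℂ P.algebra) :
    x (P.ofContinuousMap hP f) = f (P.spectrumHomeomorph hP x) := by
  have h := (gelfandStarTransform P.algebra).apply_symm_apply
    (ContinuousMap.compStarAlgHom' ℂ ℂ (P.spectrumHomeomorph hP :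
      C(WeakDual.characterSpace ℂ P.algebra, Set.range (P.toMeasure hP))) f)
  exact DFunLike.congr_fun h x

theorem ofContinuousMap_eq {f : C(Set.range (P.toMeasure hP), ℂ)} {a : P.algebra}
    (h : ∀ x : WeakDual.characterSpace ℂ P.algebra, f (P.spectrumHomeomorph hP x) = x a) :
    P.ofContinuousMap hP f = a := by
  refine (gelfandStarTransform P.algebra).injective (ContinuousMap.ext fun x => ?_)
  exact (P.apply_ofContinuousMap hP f x).trans (h x)

theorem ofContinuousMap_surjective : Function.Surjective (P.ofContinuousMap hP) := fun a =>
  ⟨(gelfandStarTransform P.algebra a).comp ((P.spectrumHomeomorph hP).symm :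
    C(Set.range (P.toMeasure hP), WeakDual.characterSpace ℂ P.algebra)),
    P.ofContinuousMap_eq hP fun x => congrArg (gelfandStarTransform P.algebra a)
      ((P.spectrumHomeomorph hP).symm_apply_apply x)⟩

theorem denseRange_toL2_ofContinuousMap (hfull : P.IsFull) :
    DenseRange fun f => LInfty.toL2 (P.algebra.subtype.comp (P.ofContinuousMap hP) f) := by
  refine (P.dense_toL2_algebra hfull hP).mono ?_
  rintro _ ⟨a, ha, rfl⟩
  obtain ⟨f, hf⟩ := P.ofContinuousMap_surjective hP ⟨a, ha⟩
  exact ⟨f, congrArg (fun b : P.algebra => LInfty.toL2 (b : Lp ℂ ∞ P.m)) hf⟩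

/-- The translation action on the set of measures given by the spectrum of `P.algebra`. -/
def translate (t : G) (ν : Set.range (P.toMeasure hP)) : Set.range (P.toMeasure hP) :=
  ⟨MeasuresOn.shift t ν, by
    obtain ⟨_, x, rfl⟩ := ν
    rw [shift_toMeasure]
    exact ⟨_, rfl⟩⟩

theorem translate_neg_spectrumHomeomorph (t : G) (x : WeakDual.characterSpace ℂ P.algebra) :
    P.translate hP (-t) (P.spectrumHomeomorph hP x) =
      P.spectrumHomeomorph hP (P.koopmanSpectrum t x) := by
  have h := P.shift_toMeasure hP (-t) x
  rw [neg_neg] at h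
  exact Subtype.ext h

theorem translate_zero (ν : Set.range (P.toMeasure hP)) : P.translate hP 0 ν = ν :=
  Subtype.ext <| DFunLike.ext _ _ fun φ => by
    change MeasuresOn.shift 0 (ν : MeasuresOn G) φ = _
    rw [MeasuresOn.shift_apply, neg_zero, ccTranslate_zero]

theorem translate_add (s t : G) (ν : Set.range (P.toMeasure hP)) :
    P.translate hP (s + t) ν = P.translate hP s (P.translate hP t ν) :=
  Subtype.ext <| DFunLike.ext _ _ fun φ => by
    change MeasuresOn.shift (s + t) (ν : MeasuresOn G) φ =
      MeasuresOn.shift s (MeasuresOn.shift t (ν : MeasuresOn G)) φ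
    rw [MeasuresOn.shift_apply, MeasuresOn.shift_apply, MeasuresOn.shift_apply,
      ← ccTranslate_add, neg_add_rev]

/-- The action is jointly continuous: `(α_t ν)(φ) = x (N (τ_{-t} φ))` if `ν` is given by `x`, and
both `t ↦ N (τ_{-t} φ)`, with the norm on `P.algebra`, and the Gelfand transform, with the
supremum norm, are continuous. -/
theorem continuous_translate [LocallyCompactSpace G] :
    Continuous fun p : G × Set.range (P.toMeasure hP) => P.translate hP p.1 p.2 := by
  refine Continuous.subtype_mk (WeakDual.continuous_of_continuous_eval fun φ => ?_) _
  have h1 : Continuous fun p : G × Set.range (P.toMeasure hP) =>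
      WeakDual.gelfandTransform ℂ P.algebra (P.algebraNL hP (ccTranslate (-p.1) φ)) :=
    (gelfandTransform_isometry P.algebra).continuous.comp <| (P.algebraNL hP).continuous.comp <|
      (continuous_ccTranslate φ).comp continuous_fst.neg
  refine (h1.eval ((P.spectrumHomeomorph hP).symm.continuous.comp continuous_snd)).congr
    fun p => ?_
  obtain ⟨t, ν⟩ := p
  obtain ⟨x, rfl⟩ := (P.spectrumHomeomorph hP).surjective ν
  simp only [Function.comp_apply, Homeomorph.symm_apply_apply]
  rfl

/-- The Gelfand isomorphism turns `f ∘ α_{-t}` into the Koopman operator `T_t`. -/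
theorem ofContinuousMap_comp_translate [LocallyCompactSpace G] (t : G)
    (f g : C(Set.range (P.toMeasure hP), ℂ)) (h : ∀ ν, g ν = f (P.translate hP (-t) ν)) :
    P.ofContinuousMap hP g = P.koopmanAlgebra t (P.ofContinuousMap hP f) := by
  refine P.ofContinuousMap_eq hP fun x => ?_
  exact (h _).trans <| (congrArg f (P.translate_neg_spectrumHomeomorph hP t x)).trans
    (P.apply_ofContinuousMap hP f (P.koopmanSpectrum t x)).symm

/-- Both measures are regular, and the integrals of continuous functions agree as the Koopman
operators on `P.algebra` preserve the integral with respect to `P.m`. -/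
theorem map_translate_eq [LocallyCompactSpace G] (ν : Measure (Set.range (P.toMeasure hP)))
    [IsFiniteMeasure ν] [ν.Regular]
    (hν : ∀ f : C(Set.range (P.toMeasure hP), ℂ),
      ∫ y, f y ∂ν = ∫ x, (P.ofContinuousMap hP f : Lp ℂ ∞ P.m) x ∂P.m) (t : G) :
    ν.map (P.translate hP t) = ν := by
  have hcont : ∀ t, Continuous (P.translate hP t) := fun t =>
    (P.continuous_translate hP).comp (Continuous.prodMk_right t)
  let e : Set.range (P.toMeasure hP) ≃ₜ Set.range (P.toMeasure hP) :=
    { toFun := P.translate hP t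
      invFun := P.translate hP (-t)
      left_inv y := by rw [← translate_add, neg_add_cancel, translate_zero]
      right_inv y := by rw [← translate_add, add_neg_cancel, translate_zero]
      continuous_toFun := hcont t
      continuous_invFun := hcont (-t) }
  have hreg : (ν.map (P.translate hP t)).Regular := Measure.Regular.map e
  refine Measure.ext_of_integral_eq_on_compactlySupported fun f => ?_
  rw [integral_map (hcont t).measurable.aemeasurable (map_continuous f).aestronglyMeasurable,
    ← Complex.ofReal_inj]
  refine (integral_ofReal (𝕜 := ℂ)).symm.trans (Eq.trans ?_ (integral_ofReal (𝕜 := ℂ)))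
  let g : C(Set.range (P.toMeasure hP), ℂ) := ⟨fun y => (f y : ℂ), by fun_prop⟩
  let g' : C(Set.range (P.toMeasure hP), ℂ) := g.comp ⟨_, hcont t⟩
  have h := P.ofContinuousMap_comp_translate hP (-t) g g' fun y => by rw [neg_neg]; rfl
  calc ∫ y, g' y ∂ν = ∫ x, (P.ofContinuousMap hP g' : Lp ℂ ∞ P.m) x ∂P.m := hν g'
    _ = ∫ x, (P.koopmanAlgebra (-t) (P.ofContinuousMap hP g) : Lp ℂ ∞ P.m) x ∂P.m :=
      congrArg (fun a : P.algebra => ∫ x, (a : Lp ℂ ∞ P.m) x ∂P.m) h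
    _ = ∫ x, (P.ofContinuousMap hP g : Lp ℂ ∞ P.m) x ∂P.m := P.integral_koopmanAlgebra _ _
    _ = ∫ y, g y ∂ν := (hν g).symm

end SpatialProcess

end

/-! ### The isomorphism -/

theorem mainTheorem1 {G : Type*} [AddCommGroup G] [TopologicalSpace G] [IsTopologicalAddGroup G]
    [T2Space G] [LocallyCompactSpace G] [SigmaCompactSpace G] [MeasurableSpace G] [BorelSpace G]
    {X : Type*} [MeasurableSpace X] (P : SpatialProcess G X) (hfull : P.IsFull)
    (hbdd : ∀ φ, MemLp (P.N φ) ∞ P.m) :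
    ∃ (Y : Set (MeasuresOn G)) (Q : SpatialProcess G Y),
      Q.IsTBMDS ∧ P.Equivalent Q ∧
      ∃ Θ : WeakDual.characterSpace ℂ P.algebra ≃ₜ Y,
        ∀ x φ, (Θ x : MeasuresOn G) φ = x (P.algebraN hbdd φ) := by
  let Y : Set (MeasuresOn G) := Set.range (P.toMeasure hbdd)
  have hcont : ∀ t, Continuous (P.translate hbdd t) := fun t =>
    (P.continuous_translate hbdd).comp (Continuous.prodMk_right t)
  have hdense := P.denseRange_toL2_ofContinuousMap hbdd hfull
  obtain ⟨ν, hprob, V, hreg, hint, hV⟩ := exists_measure_linearIsometryEquiv _ hdense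
  let S : ProbabilitySystem G Y :=
    { act := P.translate hbdd
      act_zero := P.translate_zero hbdd
      act_add := P.translate_add hbdd
      measurable_act t := (hcont t).measurable
      measurable_orbit y :=
        ((P.continuous_translate hbdd).comp (Continuous.prodMk_left y)).measurable
      m := ν
      isProbabilityMeasure := hprob
      invariant := P.map_translate_eq hbdd ν hint }
  have hkoopman : ∀ t (f : Lp ℂ 2 ν), V (S.koopman t f) = P.koopman t (V f) := fun t f => by
    refine (ContinuousMap.toLp_denseRange ℂ ν ℂ (by simp)).induction_on f
      (isClosed_eq (V.continuous.comp (S.koopman t).continuous)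
        ((P.koopman t).continuous.comp V.continuous)) fun a => ?_
    let b : C(Y, ℂ) := a.comp ⟨_, hcont (-t)⟩
    have hb : S.koopman t (ContinuousMap.toLp 2 ν ℂ a) = ContinuousMap.toLp 2 ν ℂ b := by
      refine Lp.ext ((Lp.coeFn_compMeasurePreserving _ (S.measurePreserving (-t))).trans ?_)
      refine ((S.measurePreserving (-t)).quasiMeasurePreserving.ae_eq_comp
        (ContinuousMap.coeFn_toLp ν a)).trans ?_
      exact (ContinuousMap.coeFn_toLp ν b).symm
    have h := congrArg (fun c : P.algebra => LInfty.toL2 (c : Lp ℂ ∞ P.m))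
      (P.ofContinuousMap_comp_translate hbdd t a b fun _ => rfl)
    exact (congrArg V hb).trans <| (hV b).trans <| h.trans <|
      (P.toL2_koopmanAlgebra t _).trans (congrArg (P.koopman t) (hV a).symm)
  -- the unitary map identifies `N φ` with evaluation of measures at `φ`
  have hN : ∀ φ, V.symm (P.N φ) =ᵐ[ν] fun y => (y : MeasuresOn G) φ := fun φ => by
    let g : C(Y, ℂ) :=
      ⟨fun y => (y : MeasuresOn G) φ, (WeakDual.eval_continuous φ).comp continuous_subtype_val⟩
    have hg : P.ofContinuousMap hbdd g = P.algebraN hbdd φ :=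
      P.ofContinuousMap_eq hbdd fun x => rfl
    have h : V.symm (P.N φ) = ContinuousMap.toLp 2 ν ℂ g := by
      rw [LinearIsometryEquiv.symm_apply_eq, hV]
      refine (LInfty.toL2_eq_iff.2 ?_).symm
      change ⇑(P.ofContinuousMap hbdd g : Lp ℂ ∞ P.m) =ᵐ[P.m] _
      rw [hg]
      exact (hbdd φ).coeFn_toLp
    rw [h]
    exact ContinuousMap.coeFn_toLp ν g
  let Q : SpatialProcess G Y :=
    { S with
      N := (V.symm : Lp ℂ 2 P.m →L[ℂ] Lp ℂ 2 ν).comp P.N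
      N_star φ := by
        refine Lp.ext ((hN (star φ)).trans ?_)
        filter_upwards [hN φ, Lp.coeFn_star (V.symm (P.N φ))] with y h1 h2
        obtain ⟨_, x, rfl⟩ := y
        exact (P.toMeasure_star hbdd x φ).trans ((congrArg star h1.symm).trans h2.symm)
      koopman_N t φ := by
        refine V.injective ((hkoopman t _).trans ?_)
        refine Eq.trans ?_ (V.apply_symm_apply _).symm
        exact (congrArg _ (V.apply_symm_apply _)).trans (P.koopman_N t φ) }
  have hY : IsCompact Y := isCompact_iff_compactSpace.2 inferInstance
  have hshift : ∀ t, ∀ ν ∈ Y, MeasuresOn.shift t ν ∈ Y := fun t ν hν =>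
    (P.translate hbdd t ⟨ν, hν⟩).2
  refine ⟨Y, Q, ?_, ⟨V.symm, ?_⟩, P.spectrumHomeomorph hbdd, fun x φ => rfl⟩
  · refine ⟨hY, fun ν hν φ => ?_, hshift, fun t ν => rfl, P.continuous_translate hbdd, hreg, hN⟩
    -- evaluation at `φ` is bounded on the compact set `Y`, which contains all translates of `ν`
    obtain ⟨C, hC⟩ := hY.exists_bound_of_continuousOn (WeakDual.eval_continuous φ).continuousOn
    refine ⟨C, fun t => ?_⟩
    have h := hC _ (hshift (-t) ν hν)
    rwa [MeasuresOn.shift_apply, neg_neg] at h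
  · refine ⟨fun φ => rfl, fun t f => ?_, fun f g h _ hg hh => ?_, fun f g h _ hg hh => ?_⟩
    · refine V.injective ((V.apply_symm_apply _).trans (Eq.symm ?_))
      exact (hkoopman t _).trans (congrArg _ (V.apply_symm_apply _))
    · exact symm_map_mul_of_map_toLp hdense hV f g h hg hh
    · exact map_mul_of_map_toLp hV f g h hg hh
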